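/- Let $\mathbb T$ be the unit circle with normalized arclength measure, let $\chi(z)=z$ on $\mathbb T$, and let $\mathrm H^2\subset L^2(\mathbb T)$ be the classical Hardy space, i.e. the space of $f\in L^2(\mathbb T)$ whose negative Fourier coefficients all vanish. For a linear subspace $\mathcal V\subset\mathbb C\oplus\mathbb C\chi$ (the span of $1$ and $\chi$) put $\mathrm H^2_{\mathcal V}=\mathrm H^2\ominus\mathcal V$, the space of elements of $\mathrm H^2$ orthogonal to $\mathcal V$, and let $P_{\mathcal V}$ be the orthogonal projection of $L^2(\mathbb T)$ onto $\mathrm H^2_{\mathcal V}$. Let $\phi\in L^\infty(\mathbb T)$ be real-valued, and let $T^{\mathcal V}_\phi:\mathrm H^2_{\mathcal V}\to\mathrm H^2_{\mathcal V}$, $T^{\mathcal V}_\phi f=P_{\mathcal V}(\phi f)$, be the Toeplitz operator on $\mathrm H^2_{\mathcal V}$ with symbol $\phi$. A number $\lambda\in\mathbb C$ is called an eigenvalue of $\phi$ relative to the Neil algebra $\mathcal A$ (the algebra of all $f$ in the disc algebra with $f'(0)=0$) if there are a subspace $\mathcal V\subset\mathbb C\oplus\mathbb C\chi$ and a nonzero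 $g\in\mathrm H^2_{\mathcal V}$ with $T^{\mathcal V}_\phi g=\lambda g$. Then the set of eigenvalues of $\phi$ relative to $\mathcal A$ is either empty, a single real point, or a (nondegenerate) interval of real numbers. -/

import Mathlib

open MeasureTheory
open scoped ENNReal

noncomputable section

namespace NeilToeplitz

instance instFactTwoPiPos : Fact (0 < 2 * Real.pi) := ⟨Real.two_pi_pos⟩

/-- The unit circle, parametrized as `t ↦ e^{it}` by `ℝ / 2πℤ`. The monomial `z ^ n` restricted to
the circle is `fourier n`. -/
abbrev Torus : Type := AddCircle (2 * Real.pi)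

/-- Normalized arclength measure on the unit circle. -/
abbrev arc : Measure Torus := AddCircle.haarAddCircle

/-- The complex Hilbert space `L²` of the circle. -/
abbrev L2 : Type := Lp ℂ 2 arc

/-- The monomial `z ^ n` as an element of `L²`. -/
abbrev zpowL2 (n : ℤ) : L2 := fourierLp 2 n

/-- The classical Hardy space `H²` of the disc, identified through boundary values with the space
of all `L²` functions on the circle whose negative Fourier coefficients vanish. -/
def hardy : Submodule ℂ L2 where
  carrier := {f | ∀ n : ℤ, n < 0 → fourierCoeff (f : Torus → ℂ) n = 0}
  zero_mem' := by
    intro n _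
    rw [← fourierBasis_repr]
    simp
  add_mem' := by
    intro f g hf hg n hn
    have hf' := hf n hn
    have hg' := hg n hn
    rw [← fourierBasis_repr] at hf' hg' ⊢
    simp [hf', hg']
  smul_mem' := by
    intro c f hf n hn
    have hf' := hf n hn
    rw [← fourierBasis_repr] at hf' ⊢
    simp [hf']

theorem isClosed_hardy : IsClosed (hardy : Set L2) := by
  have h : (hardy : Set L2) =
      ⋂ (n : ℤ) (_ : n < 0), {f : L2 | inner ℂ (zpowL2 n) f = 0} := by
    ext f
    simp only [Set.mem_iInter, Set.mem_ofPred_eq]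
    refine forall₂_congr fun n _ => ?_
    rw [← fourierBasis_repr, HilbertBasis.repr_apply_apply, coe_fourierBasis]
  rw [h]
  exact isClosed_iInter fun n => isClosed_iInter fun _ =>
    isClosed_eq (continuous_const.inner continuous_id) continuous_const

/-- The two-dimensional space `ℂ ⊕ ℂ z` of polynomials of degree at most one, inside `H²`. -/
def affinePolys : Submodule ℂ L2 := Submodule.span ℂ {zpowL2 0, zpowL2 1}

/-- The space `H²_V = H² ⊖ V`: the elements of `H²` that are orthogonal to `V`. -/
def hardyMinus (V : Submodule ℂ L2) : Submodule ℂ L2 := hardy ⊓ Vᗮ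

instance instCompleteSpaceHardyMinus (V : Submodule ℂ L2) : CompleteSpace (hardyMinus V) := by
  have h : IsClosed (hardyMinus V : Set L2) := by
    simpa [hardyMinus] using isClosed_hardy.inter V.isClosed_orthogonal
  exact h.completeSpace_coe

/-- Multiplication by a real-valued `L^∞` function, as a bounded operator on `L²`. -/
def mulOp (φ : Lp ℝ ∞ arc) : L2 →L[ℂ] L2 :=
  LinearMap.mkContinuous
    { toFun := fun f => (φ • f : L2)
      map_add' := fun f g => Lp.add_smul φ f g
      map_smul' := by
        intro c f
        refine Lp.ext ?_
        filter_upwards [Lp.coeFn_lpSMul (r := 2) φ (c • f), Lp.coeFn_lpSMul (r := 2) φ f,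
          Lp.coeFn_smul c f, Lp.coeFn_smul c (φ • f : L2)] with x h1 h2 h3 h4
        simp only [RingHom.id_apply]
        rw [h1, h4]
        simp only [Pi.smul_apply, Pi.smul_apply', h2, h3]
        exact smul_comm _ _ _ }
    ‖φ‖ (fun f => Lp.norm_smul_le φ f)

/-- The Toeplitz operator with symbol `φ` on `H²_V`: `f ↦ P_V (φ f)`, where `P_V` is the orthogonal
projection of `L²` onto `H²_V`. -/
def toeplitz (φ : Lp ℝ ∞ arc) (V : Submodule ℂ L2) : hardyMinus V →L[ℂ] hardyMinus V :=
  (hardyMinus V).orthogonalProjectionOnto ∘L mulOp φ ∘L (hardyMinus V).subtypeL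

/-- The set of eigenvalues of `φ` relative to the Neil algebra: those complex `l` such that, for
some subspace `V` of `ℂ ⊕ ℂ z`, the equation `T g = l g` for the Toeplitz operator `T` on `H²_V`
with symbol `φ` has a nonzero solution `g` in `H²_V`. -/
def eigenvaluesNeil (φ : Lp ℝ ∞ arc) : Set ℂ :=
  {l | ∃ V : Submodule ℂ L2, V ≤ affinePolys ∧
    ∃ g : hardyMinus V, g ≠ 0 ∧ toeplitz φ V g = l • g}

end NeilToeplitz

end

open MeasureTheory Filter Topology
open scoped ENNReal ComplexConjugate

noncomputable section

namespace NeilToeplitz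

/-! If `g` is an eigenvector on `H²_V` for `x`, then `x` is real by self-adjointness, and `(φ - x)
g` is orthogonal to `g` and to `z ^ n g` for `n ≥ 2`, since those lie in `H²_V` whatever `V` is.
Hence the real function `(φ - x)|g|²` has Fourier coefficients only at `±1`: it equals `2 Re (c z)`
(`exists_of_mem_eigenvaluesNeil`).

Conversely, if `(φ - ν) s² = 2 Re (d z)` with `s` real and bounded and `d ≠ 0`, then `ν` is an
eigenvalue (`mem_eigenvaluesNeil_of_mul_sq`). The eigenvector is `conj (s u)`, where `u` solves
Szegő's extremal problem for `s`; this avoids factoring `s²` as the squared modulus of an outer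
function.

Given eigenvalues `x < y` with nonzero `c` and `d`, comparing signs makes `c` a positive multiple of
`d`, so `φ` is above `y` on one half circle and below `x` on the other. For `x < ν < y` the quotient
`2 Re (d z) / (φ - ν)` is then bounded and nonnegative, and its square root serves as `s`. The case
`c = 0` excludes a second eigenvalue because `H²` has no zero divisors
(`eq_of_mul_norm_sq_eq_zero`). -/

/-! ### Uniqueness of Fourier coefficients in `L¹`. -/

/-- An integrable function on the circle all of whose Fourier coefficients vanish is zero. -/
theorem ae_eq_zero_of_integral_fourier_mul {F : Torus → ℂ} (hF : Integrable F arc)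
    (h : ∀ n : ℤ, ∫ t, fourier n t * F t ∂arc = 0) : F =ᵐ[arc] 0 := by
  have hint : ∀ G : C(Torus, ℂ), Integrable (fun t => G t * F t) arc := fun G =>
    hF.bdd_mul (c := ‖G‖) G.continuous.aestronglyMeasurable
      (Eventually.of_forall fun t => G.norm_coe_le_norm t)
  let L : C(Torus, ℂ) →L[ℂ] ℂ := LinearMap.mkContinuous
    { toFun := fun G => ∫ t, G t * F t ∂arc
      map_add' := fun G H => by
        simp only [ContinuousMap.add_apply, add_mul]
        exact integral_add (hint G) (hint H)
      map_smul' := fun c G => by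
        simp only [ContinuousMap.smul_apply, smul_eq_mul, mul_assoc, RingHom.id_apply]
        exact integral_const_mul _ _ } (∫ t, ‖F t‖ ∂arc) (fun G => by
      refine (norm_integral_le_integral_norm _).trans ?_
      rw [← integral_mul_const]
      refine integral_mono (hint G).norm (hF.norm.mul_const _) fun t => ?_
      simp only [norm_mul]
      rw [mul_comm]
      gcongr
      exact G.norm_coe_le_norm t)
  have hker : ∀ G : C(Torus, ℂ), L G = 0 := by
    have : (⊤ : Submodule ℂ C(Torus, ℂ)) ≤ L.ker := by
      rw [← span_fourier_closure_eq_top]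
      refine Submodule.topologicalClosure_minimal _ ?_ L.isClosed_ker
      rw [Submodule.span_le]
      rintro _ ⟨n, rfl⟩
      exact h n
    exact fun G => this (Submodule.mem_top)
  -- Indicators of closed sets are bounded pointwise limits of continuous functions, which `F`
  -- annihilates.
  refine ae_eq_zero_of_forall_setIntegral_isClosed_eq_zero hF fun s hs => ?_
  have hlim : Tendsto (fun n => ∫ t, ((hs.apprSeq n t : ℝ) : ℂ) * F t ∂arc) atTop
      (𝓝 (∫ t, s.indicator F t ∂arc)) := by
    refine tendsto_integral_of_dominated_convergence (fun t => ‖F t‖) (fun n => ?_) hF.norm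
      (fun n => Eventually.of_forall fun t => ?_) (Eventually.of_forall fun t => ?_)
    · refine AEStronglyMeasurable.mul ?_ hF.aestronglyMeasurable
      exact (by fun_prop : Continuous fun t => ((hs.apprSeq n t : ℝ) : ℂ)).aestronglyMeasurable
    · rw [norm_mul]
      refine mul_le_of_le_one_left (norm_nonneg _) ?_
      have := HasOuterApproxClosed.apprSeq_apply_le_one hs n t
      simpa using this
    · have h1 := tendsto_pi_nhds.1 (HasOuterApproxClosed.tendsto_apprSeq hs) t
      have h2 : Tendsto (fun n => ((hs.apprSeq n t : ℝ) : ℂ)) atTop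
          (𝓝 (((s.indicator (fun _ => (1 : NNReal)) t : NNReal) : ℝ) : ℂ)) :=
        (Complex.continuous_ofReal.tendsto _).comp ((NNReal.continuous_coe.tendsto _).comp h1)
      convert h2.mul_const (F t) using 2
      by_cases ht : t ∈ s <;> simp [ht]
  rw [integral_indicator hs.measurableSet] at hlim
  refine tendsto_nhds_unique hlim ?_
  refine tendsto_const_nhds.congr fun n => ?_
  exact (hker ⟨fun t => ((hs.apprSeq n t : ℝ) : ℂ), by fun_prop⟩).symm

/-! ### Shifts, conjugation and multiplication in terms of Fourier coefficients. -/

theorem zpowL2_coe (n : ℤ) : (zpowL2 n : Torus → ℂ) =ᵐ[arc] fourier n := coeFn_fourierLp 2 n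

theorem mem_hardy_iff {f : L2} : f ∈ hardy ↔ ∀ n : ℤ, n < 0 → inner ℂ (zpowL2 n) f = 0 := by
  refine forall₂_congr fun n _ => ?_
  rw [← fourierBasis_repr, HilbertBasis.repr_apply_apply, coe_fourierBasis]

theorem inner_eq_integral (f g : L2) : inner ℂ f g = ∫ t, conj (f t) * g t ∂arc := by
  rw [L2.inner_def]
  simp [RCLike.inner_apply, mul_comm]

theorem inner_zpowL2 (n : ℤ) (f : L2) :
    inner ℂ (zpowL2 n) f = ∫ t, fourier (-n) t * f t ∂arc := by
  rw [inner_eq_integral]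
  refine integral_congr_ae ?_
  filter_upwards [zpowL2_coe n] with t ht
  rw [ht, fourier_neg]

theorem eq_zero_of_inner_zpowL2 {f : L2} (h : ∀ n, inner ℂ (zpowL2 n) f = 0) : f = 0 := by
  refine (@fourierBasis _ instFactTwoPiPos).repr.injective ?_
  ext n
  rw [HilbertBasis.repr_apply_apply, coe_fourierBasis, h n]
  simp

theorem inner_zpowL2_zpowL2 (m n : ℤ) :
    inner ℂ (zpowL2 m) (zpowL2 n) = if m = n then 1 else 0 :=
  orthonormal_iff_ite.1 orthonormal_fourier m n

/-- Multiplication by `z ^ n` on `L²`. -/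
def shift (n : ℤ) : L2 →L[ℂ] L2 :=
  (ContinuousLinearMap.mul ℂ ℂ).holderL arc ∞ 2 2 (fourierLp ∞ n)

theorem shift_coe (n : ℤ) (f : L2) :
    (shift n f : Torus → ℂ) =ᵐ[arc] fun t => fourier n t * f t := by
  filter_upwards [(ContinuousLinearMap.mul ℂ ℂ).coeFn_holder (r := 2) (fourierLp ∞ n) f,
    coeFn_fourierLp (T := 2 * Real.pi) ∞ n] with t h1 h2
  rw [shift, ContinuousLinearMap.holderL_apply_apply, h1, h2]
  simp

theorem mulOp_coe (φ : Lp ℝ ∞ arc) (f : L2) :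
    (mulOp φ f : Torus → ℂ) =ᵐ[arc] fun t => (φ t : ℂ) * f t := by
  filter_upwards [Lp.coeFn_lpSMul (r := 2) φ f] with t h1
  exact h1.trans (by simp)

theorem inner_zpowL2_shift (m n : ℤ) (f : L2) :
    inner ℂ (zpowL2 m) (shift n f) = inner ℂ (zpowL2 (m - n)) f := by
  rw [inner_zpowL2, inner_zpowL2]
  refine integral_congr_ae ?_
  filter_upwards [shift_coe n f] with t ht
  rw [ht, ← mul_assoc, ← fourier_add]
  congr 3
  ring

theorem star_coe (f : L2) : (star f : L2) =ᵐ[arc] fun t => conj (f t) := Lp.coeFn_star f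

theorem inner_zpowL2_star (n : ℤ) (f : L2) :
    inner ℂ (zpowL2 n) (star f) = conj (inner ℂ (zpowL2 (-n)) f) := by
  rw [inner_zpowL2, inner_zpowL2, ← integral_conj]
  refine integral_congr_ae ?_
  filter_upwards [star_coe f] with t ht
  rw [ht, neg_neg, map_mul, ← fourier_neg]

theorem integrable_conj_mul (f g : L2) : Integrable (fun t => conj (f t) * g t) arc :=
  (Lp.memLp f).star.integrable_mul (Lp.memLp g)

theorem inner_mulOp_left (φ : Lp ℝ ∞ arc) (f g : L2) :
    inner ℂ (mulOp φ f) g = inner ℂ f (mulOp φ g) := by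
  rw [inner_eq_integral, inner_eq_integral]
  refine integral_congr_ae ?_
  filter_upwards [mulOp_coe φ f, mulOp_coe φ g] with t h1 h2
  simp only [h1, h2, map_mul, Complex.conj_ofReal]
  ring

theorem shift_mem_hardy {f : L2} (hf : f ∈ hardy) {n : ℤ} (hn : 0 ≤ n) : shift n f ∈ hardy := by
  rw [mem_hardy_iff] at hf ⊢
  intro m hm
  rw [inner_zpowL2_shift]
  exact hf _ (by lia)

theorem shift_mem_affinePolys_orthogonal {f : L2} (hf : f ∈ hardy) {n : ℤ} (hn : 2 ≤ n) :
    shift n f ∈ affinePolysᗮ := by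
  rw [mem_hardy_iff] at hf
  rw [Submodule.mem_orthogonal]
  intro v hv
  rw [affinePolys, Submodule.mem_span_pair] at hv
  obtain ⟨a, b, rfl⟩ := hv
  rw [inner_add_left, inner_smul_left, inner_smul_left, inner_zpowL2_shift, inner_zpowL2_shift,
    hf _ (by lia), hf _ (by lia)]
  simp

/-! ### Zero divisors and rotations in the Hardy space. -/

/-- The Hardy space has no zero divisors. -/
theorem eq_zero_or_eq_zero_of_mul_ae_eq_zero {g h : L2} (hg : g ∈ hardy) (hh : h ∈ hardy)
    (hgh : ∀ᵐ t ∂arc, g t * h t = 0) : g = 0 ∨ h = 0 := by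
  rw [mem_hardy_iff] at hg hh
  by_contra! hne
  have key : ∀ f : L2, f ≠ 0 → (∀ n : ℤ, n < 0 → inner ℂ (zpowL2 n) f = 0) →
      ∃ m : ℕ, inner ℂ (zpowL2 m) f ≠ 0 ∧ ∀ n : ℤ, n < m → inner ℂ (zpowL2 n) f = 0 := by
    intro f hf0 hf
    have hex : ∃ m : ℕ, inner ℂ (zpowL2 m) f ≠ 0 := by
      by_contra! hall
      refine hf0 (eq_zero_of_inner_zpowL2 fun n => ?_)
      rcases lt_or_ge n 0 with hn | hn
      · exact hf n hn
      · lift n to ℕ using hn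
        exact hall n
    classical
    refine ⟨Nat.find hex, Nat.find_spec hex, fun n hn => ?_⟩
    rcases lt_or_ge n 0 with hn0 | hn0
    · exact hf n hn0
    · lift n to ℕ using hn0
      exact not_not.1 (Nat.find_min hex (by exact_mod_cast hn))
  obtain ⟨m, hm, hm'⟩ := key g hne.1 hg
  obtain ⟨k, hk, hk'⟩ := key h hne.2 hh
  -- With `m`, `k` the orders of vanishing of `g`, `h` at the origin, this is coefficient `m + k` of
  -- `g h`. Parseval reduces it to the product of the two lowest coefficients.
  have h0 : inner ℂ (star g) (shift (-(m + k)) h) = 0 := by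
    rw [inner_eq_integral]
    refine integral_eq_zero_of_ae ?_
    filter_upwards [star_coe g, shift_coe (-(m + k)) h, hgh] with t h1 h2 h3
    rw [h1, h2, Complex.conj_conj, mul_left_comm, h3, mul_zero]
    rfl
  have hsum := (@fourierBasis _ instFactTwoPiPos).tsum_inner_mul_inner (star g)
    (shift (-(m + k)) h)
  rw [coe_fourierBasis, h0, tsum_eq_single (-m : ℤ)] at hsum
  · rw [← inner_conj_symm, inner_zpowL2_star, inner_zpowL2_shift, Complex.conj_conj, neg_neg,
      mul_eq_zero] at hsum
    rcases hsum with h1 | h1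
    · exact hm h1
    · refine hk ?_
      rwa [show (-m - -(m + k) : ℤ) = k by ring] at h1
  · intro i hi
    rw [← inner_conj_symm, inner_zpowL2_star, inner_zpowL2_shift, Complex.conj_conj]
    rcases lt_or_gt_of_ne hi with h1 | h1
    · rw [hk' _ (by lia), mul_zero]
    · rw [hm' _ (by lia), zero_mul]

/-- Rotation by the angle `a` on `L²`. -/
def rotate (a : Torus) (f : L2) : L2 :=
  Lp.compMeasurePreserving (· + a) (measurePreserving_add_right arc a) f

theorem rotate_coe (a : Torus) (f : L2) :
    (rotate a f : Torus → ℂ) =ᵐ[arc] fun t => f (t + a) :=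
  Lp.coeFn_compMeasurePreserving f (measurePreserving_add_right arc a)

theorem inner_zpowL2_rotate (n : ℤ) (a : Torus) (f : L2) :
    inner ℂ (zpowL2 n) (rotate a f) = fourier n a * inner ℂ (zpowL2 n) f := by
  rw [inner_zpowL2, inner_zpowL2, ← integral_const_mul,
    ← integral_add_right_eq_self (fun t => fourier n a * (fourier (-n) t * f t)) a]
  refine integral_congr_ae ?_
  filter_upwards [rotate_coe a f] with t ht
  have h1 : fourier (-n) (t + a) = fourier (-n) t * fourier (-n) a := by
    simp [fourier_apply, smul_add, AddCircle.toCircle_add]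
  have h2 : fourier n a * fourier (-n) a = (1 : ℂ) := by
    rw [← fourier_add]
    simp
  rw [ht, h1]
  linear_combination (-fourier (-n) t * f (t + a)) * h2

theorem rotate_mem_hardy {f : L2} (hf : f ∈ hardy) (a : Torus) : rotate a f ∈ hardy := by
  rw [mem_hardy_iff] at hf ⊢
  intro n hn
  rw [inner_zpowL2_rotate, hf n hn, mul_zero]

theorem rotate_eq_zero {f : L2} {a : Torus} (h : rotate a f = 0) : f = 0 := by
  refine eq_zero_of_inner_zpowL2 fun n => ?_
  have h1 := inner_zpowL2_rotate n a f
  rw [h, inner_zero_right, eq_comm, mul_eq_zero] at h1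
  refine h1.resolve_left ?_
  rw [fourier_apply]
  exact Circle.coe_ne_zero _

/-! ### Real integrable functions with spectrum in `{-1, 0, 1}`. -/

theorem integral_fourier_mul_fourier (m n : ℤ) :
    ∫ t, fourier m t * fourier n t ∂arc = if m + n = 0 then 1 else 0 := by
  have h := inner_zpowL2_zpowL2 (-m) n
  rw [inner_zpowL2, neg_neg] at h
  have h2 : ∫ t, fourier m t * fourier n t ∂arc = ∫ t, fourier m t * zpowL2 n t ∂arc := by
    refine integral_congr_ae ?_
    filter_upwards [zpowL2_coe n] with t ht
    rw [ht]
  rw [h2, h]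
  refine if_congr ?_ rfl rfl
  lia

theorem ofReal_two_mul_re (c : ℂ) (t : Torus) :
    ((2 * (c * fourier 1 t).re : ℝ) : ℂ) = c * fourier 1 t + conj c * fourier (-1) t := by
  rw [fourier_neg, ← map_mul, Complex.add_conj]

/-- Realness makes the coefficients at `n` and `-n` conjugate, so vanishing for `n ≥ 2` suffices.
`F` is only in `L¹`, as `(φ - x)|g|²` will be. -/
theorem ae_eq_of_integral_fourier_mul_eq_zero {F : Torus → ℝ} (hF : Integrable F arc)
    (h : ∀ n : ℤ, 2 ≤ n → ∫ t, fourier (-n) t * (F t : ℂ) ∂arc = 0) :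
    ∀ᵐ t ∂arc, F t = ∫ t, F t ∂arc +
      2 * ((∫ t, fourier (-1) t * (F t : ℂ) ∂arc) * fourier 1 t).re := by
  set c := ∫ t, fourier (-1) t * (F t : ℂ) ∂arc with hc
  set D := ∫ t, F t ∂arc with hD
  have hFc : Integrable (fun t => (F t : ℂ)) arc := hF.ofReal
  have hint : ∀ m n : ℤ, Integrable (fun t : Torus => fourier m t * fourier n t) arc := fun m n =>
    (by fun_prop : Continuous fun t : Torus => fourier m t * fourier n t).integrable_of_hasCompactSupport
      (HasCompactSupport.of_compactSpace _)
  have hint0 : ∀ m : ℤ, Integrable (fun t : Torus => fourier m t * (F t : ℂ)) arc := fun m =>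
    hFc.bdd_mul (c := ‖fourier (T := 2 * Real.pi) m‖)
      (fourier m).continuous.aestronglyMeasurable
      (Eventually.of_forall fun t => (fourier m).norm_coe_le_norm t)
  have hneg : ∀ n : ℤ, ∫ t, fourier n t * (F t : ℂ) ∂arc
      = conj (∫ t, fourier (-n) t * (F t : ℂ) ∂arc) := by
    intro n
    rw [← integral_conj]
    refine integral_congr_ae (Eventually.of_forall fun t => ?_)
    simp only [map_mul, Complex.conj_ofReal]
    rw [← fourier_neg, neg_neg]
  have hz : (fun t => (F t : ℂ) - (D * fourier 0 t + (c * fourier 1 t + conj c * fourier (-1) t)))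
      =ᵐ[arc] 0 := by
    refine ae_eq_zero_of_integral_fourier_mul (hFc.sub ?_) fun n => ?_
    · exact (by fun_prop : Continuous fun t : Torus => (D * fourier 0 t + (c * fourier 1 t +
        conj c * fourier (-1) t) : ℂ)).integrable_of_hasCompactSupport
        (HasCompactSupport.of_compactSpace _)
    · have hsplit : ∀ t : Torus, fourier n t * ((F t : ℂ) - (D * fourier 0 t + (c * fourier 1 t +
          conj c * fourier (-1) t))) = fourier n t * (F t : ℂ) - (D * (fourier n t * fourier 0 t)
          + (c * (fourier n t * fourier 1 t) + conj c * (fourier n t * fourier (-1) t))) := by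
        intro t
        ring
      simp_rw [hsplit]
      have I : ∀ (a : ℂ) (m : ℤ), Integrable (fun t : Torus => a * (fourier n t * fourier m t)) arc :=
        fun a m => (hint n m).const_mul a
      have I' : Integrable (fun t : Torus => c * (fourier n t * fourier 1 t) +
          conj c * (fourier n t * fourier (-1) t)) arc := (I _ _).add (I _ _)
      have I'' : Integrable (fun t : Torus => D * (fourier n t * fourier 0 t) +
          (c * (fourier n t * fourier 1 t) + conj c * (fourier n t * fourier (-1) t))) arc :=
        (I _ _).add I'
      rw [integral_sub (hint0 n) I'', integral_add (I _ _) I', integral_add (I _ _) (I _ _),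
        integral_const_mul, integral_const_mul, integral_const_mul,
        integral_fourier_mul_fourier, integral_fourier_mul_fourier, integral_fourier_mul_fourier]
      obtain hn | rfl | rfl | rfl | hn :
        n ≤ -2 ∨ n = -1 ∨ n = 0 ∨ n = 1 ∨ 2 ≤ n := by lia
      · have := h (-n) (by lia)
        rw [neg_neg] at this
        rw [this, if_neg (by lia), if_neg (by lia), if_neg (by lia)]
        simp
      · rw [← hc]
        simp
      · have : ∫ t, fourier 0 t * (F t : ℂ) ∂arc = D := by
          simp only [fourier_zero, one_mul]
          exact integral_ofReal
        rw [this]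
        simp
      · rw [hneg 1, ← hc]
        simp
      · rw [hneg, h n hn, if_neg (by lia), if_neg (by lia), if_neg (by lia)]
        simp
  filter_upwards [hz] with t ht
  rw [Pi.zero_apply, sub_eq_zero, ← ofReal_two_mul_re, fourier_zero, mul_one] at ht
  exact_mod_cast ht

/-! ### From an eigenvector to a trigonometric polynomial. -/

theorem conj_inner_mulOp_self (φ : Lp ℝ ∞ arc) (f : L2) :
    conj (inner ℂ f (mulOp φ f)) = inner ℂ f (mulOp φ f) := by
  rw [inner_conj_symm, inner_mulOp_left]

/-- Shifting by at least `2` kills the coefficients at `0` and `1`, hence the same argument serves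
every `V`. -/
theorem shift_mem_hardyMinus {V : Submodule ℂ L2} (hV : V ≤ affinePolys) {f : L2}
    (hf : f ∈ hardyMinus V) {n : ℤ} (hn : 2 ≤ n) : shift n f ∈ hardyMinus V :=
  ⟨shift_mem_hardy hf.1 (by lia),
    Submodule.orthogonal_le hV (shift_mem_affinePolys_orthogonal hf.1 hn)⟩

/-- The symbol has a rigid form near an eigenvector: `(φ - x) |g|² = 2 Re (c z)`. -/
theorem exists_of_mem_eigenvaluesNeil {φ : Lp ℝ ∞ arc} {l : ℂ} (hl : l ∈ eigenvaluesNeil φ) :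
    ∃ x : ℝ, l = x ∧ ∃ g ∈ hardy, g ≠ 0 ∧ ∃ c : ℂ,
      ∀ᵐ t ∂arc, (φ t - x) * ‖g t‖ ^ 2 = 2 * (c * fourier 1 t).re := by
  obtain ⟨V, hV, g, hg0, hg⟩ := hl
  have hin : ∀ f ∈ hardyMinus V, inner ℂ f (mulOp φ g) = l * inner ℂ f (g : L2) := by
    intro f hf
    have h1 : inner ℂ (⟨f, hf⟩ : hardyMinus V) (toeplitz φ V g) = inner ℂ f (mulOp φ g) :=
      Submodule.inner_orthogonalProjectionOnto_eq_of_mem_left (⟨f, hf⟩ : hardyMinus V) _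
    rw [← h1, hg]
    exact inner_smul_right (𝕜 := ℂ) f (g : L2) l
  have hg0' : (g : L2) ≠ 0 := fun h => hg0 (Subtype.ext h)
  have hlr : conj l = l := by
    have h1 := conj_inner_mulOp_self φ (g : L2)
    rw [hin g g.2, map_mul, inner_conj_symm] at h1
    exact mul_right_cancel₀ (inner_self_ne_zero.2 hg0') h1
  obtain ⟨x, rfl⟩ := Complex.conj_eq_iff_real.1 hlr
  refine ⟨x, rfl, g, g.2.1, hg0', ∫ t, fourier (-1) t * (((φ t - x) * ‖(g : L2) t‖ ^ 2 : ℝ) : ℂ)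
    ∂arc, ?_⟩
  set w : L2 := mulOp φ g - (x : ℂ) • (g : L2) with hw
  have hwcoe : ∀ᵐ t ∂arc, conj ((g : L2) t) * w t = (((φ t - x) * ‖(g : L2) t‖ ^ 2 : ℝ) : ℂ) := by
    filter_upwards [Lp.coeFn_sub (mulOp φ g) ((x : ℂ) • (g : L2)), mulOp_coe φ g,
      Lp.coeFn_smul (x : ℂ) (g : L2)] with t h1 h2 h3
    rw [h1, Pi.sub_apply, h2, h3, Pi.smul_apply, smul_eq_mul]
    push_cast
    rw [← Complex.mul_conj']
    ring
  have hcoef : ∀ n : ℤ, ∫ t, fourier (-n) t * (((φ t - x) * ‖(g : L2) t‖ ^ 2 : ℝ) : ℂ) ∂arc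
      = inner ℂ (shift n (g : L2)) w := by
    intro n
    rw [inner_eq_integral]
    refine integral_congr_ae ?_
    filter_upwards [hwcoe, shift_coe n (g : L2)] with t h1 h2
    rw [h2, ← h1, map_mul, fourier_neg, mul_assoc]
  have hzero : ∀ f ∈ hardyMinus V, inner ℂ f w = 0 := by
    intro f hf
    rw [hw, inner_sub_right, hin f hf, inner_smul_right, sub_self]
  have hF : Integrable (fun t => (φ t - x) * ‖(g : L2) t‖ ^ 2) arc := by
    refine ((integrable_conj_mul (g : L2) w).re).congr ?_
    filter_upwards [hwcoe] with t ht
    rw [ht]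
    exact Complex.ofReal_re _
  have h0 : ∫ t, (φ t - x) * ‖(g : L2) t‖ ^ 2 ∂arc = 0 := by
    have h1 : inner ℂ (g : L2) w = 0 := hzero g g.2
    rw [inner_eq_integral, integral_congr_ae hwcoe, integral_complex_ofReal] at h1
    exact_mod_cast h1
  have := ae_eq_of_integral_fourier_mul_eq_zero hF fun n hn => by
    rw [hcoef, hzero _ (shift_mem_hardyMinus hV g.2 hn)]
  filter_upwards [this] with t ht
  rw [ht, h0, zero_add]

/-! ### Szegő's extremal problem. -/

/-- The subspace `z H²` of the Hardy space. -/
def hardyZero : Submodule ℂ L2 := hardy ⊓ (ℂ ∙ zpowL2 0)ᗮ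

theorem mem_hardyZero_iff {f : L2} : f ∈ hardyZero ↔ ∀ n : ℤ, n ≤ 0 → inner ℂ (zpowL2 n) f = 0 := by
  rw [hardyZero, Submodule.mem_inf, mem_hardy_iff, Submodule.mem_orthogonal_singleton_iff_inner_right]
  constructor
  · rintro ⟨h1, h2⟩ n hn
    rcases hn.lt_or_eq with hn | rfl
    · exact h1 n hn
    · exact h2
  · exact fun h => ⟨fun n hn => h n hn.le, h 0 le_rfl⟩

theorem zpowL2_mem_hardyZero {n : ℤ} (hn : 0 < n) : zpowL2 n ∈ hardyZero := by
  rw [mem_hardyZero_iff]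
  intro m hm
  rw [inner_zpowL2_zpowL2, if_neg (by lia)]

theorem shift_mem_hardyZero {f : L2} (hf : f ∈ hardy) {n : ℤ} (hn : 0 < n) :
    shift n f ∈ hardyZero := by
  rw [mem_hardy_iff] at hf
  rw [mem_hardyZero_iff]
  intro m hm
  rw [inner_zpowL2_shift, hf _ (by lia)]

theorem shift_mulOp (n : ℤ) (s : Lp ℝ ∞ arc) (f : L2) :
    shift n (mulOp s f) = mulOp s (shift n f) := by
  refine Lp.ext ?_
  filter_upwards [shift_coe n (mulOp s f), mulOp_coe s f, mulOp_coe s (shift n f),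
    shift_coe n f] with t h1 h2 h3 h4
  rw [h1, h2, h3, h4]
  ring

/-- Szegő's extremal problem: if `u` is the component of `s` orthogonal to `s z H²`, then `u` is a
limit of `s e` with `e ∈ 1 + z H²`, and `u` has constant modulus. -/
theorem exists_szego_extremal (s : Lp ℝ ∞ arc) :
    ∃ u : L2, u ∈ closure (mulOp s '' {e | e ∈ hardy ∧ inner ℂ (zpowL2 0) e = 1}) ∧
      (∀ f ∈ hardyZero, inner ℂ (mulOp s f) u = 0) ∧
      ∃ D : ℝ, ∀ᵐ t ∂arc, ‖u t‖ ^ 2 = D := by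
  let M : Submodule ℂ L2 := (hardyZero.map (mulOp s).toLinearMap).topologicalClosure
  have hM : ∀ f ∈ hardyZero, mulOp s f ∈ M := fun f hf =>
    Submodule.le_topologicalClosure _ (Submodule.mem_map_of_mem hf)
  have : CompleteSpace M := (Submodule.isClosed_topologicalClosure _).completeSpace_coe
  let S : L2 := mulOp s (zpowL2 0)
  let u : L2 := S - M.starProjection S
  have horth : ∀ f ∈ hardyZero, inner ℂ (mulOp s f) u = 0 := fun f hf =>
    Submodule.inner_right_of_mem_orthogonal (hM f hf)
      (Submodule.sub_starProjection_mem_orthogonal S)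
  have hcl : u ∈ closure (mulOp s '' {e | e ∈ hardy ∧ inner ℂ (zpowL2 0) e = 1}) := by
    have hp : M.starProjection S ∈ closure (mulOp s '' (hardyZero : Set L2)) :=
      M.starProjection_apply_mem S
    refine map_mem_closure (f := fun x => S - x) (by fun_prop) hp ?_
    rintro _ ⟨f, hf, rfl⟩
    have hf0 := mem_hardyZero_iff.1 hf
    refine ⟨zpowL2 0 - f, ⟨?_, ?_⟩, by rw [map_sub]⟩
    · rw [mem_hardy_iff]
      intro n hn
      rw [inner_sub_right, hf0 n hn.le, inner_zpowL2_zpowL2, if_neg (by lia), sub_zero]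
    · rw [inner_sub_right, hf0 0 le_rfl, inner_zpowL2_zpowL2, if_pos rfl, sub_zero]
  -- As `u` is a limit of `s e` with `e` in `H²`, `z ^ n u` is a limit of elements of `s z H²`, to
  -- which `u` is orthogonal. So `|u|²` has no nonzero frequency.
  have hshift : ∀ n : ℤ, 0 < n → inner ℂ (shift n u) u = 0 := by
    intro n hn
    have hclosed : IsClosed {x : L2 | inner ℂ (shift n x) u = 0} :=
      isClosed_eq (by fun_prop) continuous_const
    refine closure_minimal ?_ hclosed hcl
    rintro _ ⟨e, he, rfl⟩
    change inner ℂ (shift n (mulOp s e)) u = 0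
    rw [shift_mulOp]
    exact horth _ (shift_mem_hardyZero he.1 hn)
  refine ⟨u, hcl, horth, ∫ t, ‖u t‖ ^ 2 ∂arc, ?_⟩
  have hcoef : ∀ n : ℤ, 0 < n → ∫ t, fourier (-n) t * ((‖u t‖ ^ 2 : ℝ) : ℂ) ∂arc = 0 := by
    intro n hn
    rw [← hshift n hn, inner_eq_integral]
    refine integral_congr_ae ?_
    filter_upwards [shift_coe n u] with t h1
    rw [h1, map_mul, fourier_neg, mul_assoc, Complex.conj_mul']
    push_cast
    rfl
  have := ae_eq_of_integral_fourier_mul_eq_zero (Lp.memLp u).integrable_norm_pow'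
    fun n hn => hcoef n (by lia)
  filter_upwards [this] with t ht
  rw [hcoef 1 one_pos] at ht
  simpa using ht

/-! ### Construction of an eigenvector from a bounded `s`. -/

theorem inner_eq_zero_of_mem_hardy {f w : L2} (hf : f ∈ hardy)
    (hw : ∀ n : ℤ, 0 ≤ n → inner ℂ (zpowL2 n) w = 0) : inner ℂ f w = 0 := by
  rw [mem_hardy_iff] at hf
  rw [← (@fourierBasis _ instFactTwoPiPos).tsum_inner_mul_inner, coe_fourierBasis]
  refine (tsum_congr fun n => ?_).trans tsum_zero
  rcases lt_or_ge n 0 with hn | hn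
  · rw [← inner_conj_symm, hf n hn, map_zero, zero_mul]
  · rw [hw n hn, mul_zero]

theorem fourier_mul_fourier_neg (n : ℤ) (t : Torus) :
    fourier n t * fourier (-n) t = (1 : ℂ) := by
  rw [← fourier_add]
  simp

/-- A real number `ν` for which `φ - ν` has the form `2 Re (d z) / s²` is an eigenvalue. -/
theorem mem_eigenvaluesNeil_of_mul_sq {φ s : Lp ℝ ∞ arc} {ν : ℝ} {d : ℂ} (hd : d ≠ 0)
    (h : ∀ᵐ t ∂arc, (φ t - ν) * s t ^ 2 = 2 * (d * fourier 1 t).re) :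
    (ν : ℂ) ∈ eigenvaluesNeil φ := by
  obtain ⟨u, hcl, horth, D, hD⟩ := exists_szego_extremal s
  let T : L2 →L[ℂ] L2 := mulOp φ - (ν : ℂ) • ContinuousLinearMap.id ℂ L2
  have hT : ∀ f : L2, (T f : Torus → ℂ) =ᵐ[arc] fun t => ((φ t - ν : ℝ) : ℂ) * f t := by
    intro f
    filter_upwards [Lp.coeFn_sub (mulOp φ f) ((ν : ℂ) • f), mulOp_coe φ f,
      Lp.coeFn_smul (ν : ℂ) f] with t h1 h2 h3
    refine h1.trans ?_
    rw [Pi.sub_apply, h2, h3, Pi.smul_apply, smul_eq_mul]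
    push_cast
    ring
  -- Orthogonality of `s u` to `z H²` says exactly that its conjugate is in `H²`.
  set g : L2 := star (mulOp s u) with hg
  have hgcoe : ∀ᵐ t ∂arc, g t = s t * conj (u t) := by
    filter_upwards [star_coe (mulOp s u), mulOp_coe s u] with t h1 h2
    rw [h1, h2, map_mul, Complex.conj_ofReal]
  have hgH : g ∈ hardy := by
    rw [mem_hardy_iff]
    intro n hn
    rw [hg, inner_zpowL2_star, ← inner_mulOp_left, horth _ (zpowL2_mem_hardyZero (by lia)),
      map_zero]
  set h' : L2 := shift 1 (T (mulOp s u)) with hh'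
  obtain ⟨hhH, hh0⟩ : h' ∈ hardy ∧ inner ℂ (zpowL2 0) h' = conj d := by
    have hclosed : IsClosed {x : L2 | shift 1 (T (mulOp s x)) ∈ hardy ∧
        inner ℂ (zpowL2 0) (shift 1 (T (mulOp s x))) = conj d} :=
      (isClosed_hardy.preimage (by fun_prop)).inter
        (isClosed_eq (by fun_prop) continuous_const)
    refine closure_minimal ?_ hclosed hcl
    rintro _ ⟨e, ⟨he, he1⟩, rfl⟩
    -- Multiplying `(φ - ν) s² = d z + conj d / z` by `z e` clears the negative power.
    have hform : shift 1 (T (mulOp s (mulOp s e))) = d • shift 2 e + conj d • e := by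
      refine Lp.ext ?_
      filter_upwards [shift_coe 1 (T (mulOp s (mulOp s e))), hT (mulOp s (mulOp s e)),
        mulOp_coe s (mulOp s e), mulOp_coe s e, Lp.coeFn_add (d • shift 2 e) (conj d • e),
        Lp.coeFn_smul d (shift 2 e), Lp.coeFn_smul (conj d) e, shift_coe 2 e, h]
        with t h1 h2 h3 h4 h5 h6 h7 h8 h9
      rw [h1, h2, h3, h4, h5, Pi.add_apply, h6, h7, Pi.smul_apply, Pi.smul_apply, h8,
        smul_eq_mul, smul_eq_mul]
      have h10 := congrArg (fun r : ℝ => (r : ℂ)) h9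
      simp only [ofReal_two_mul_re] at h10
      have h11 : fourier 2 t = (fourier 1 t * fourier 1 t : ℂ) := by
        rw [← fourier_add]
        norm_num
      have h12 := fourier_mul_fourier_neg 1 t
      push_cast at h10 ⊢
      rw [h11]
      linear_combination (fourier 1 t * e t) * h10 + conj d * e t * h12
    change shift 1 (T (mulOp s (mulOp s e))) ∈ hardy ∧
        inner ℂ (zpowL2 0) (shift 1 (T (mulOp s (mulOp s e)))) = conj d
    rw [hform]
    refine ⟨hardy.add_mem (hardy.smul_mem _ (shift_mem_hardy he (by norm_num)))
      (hardy.smul_mem _ he), ?_⟩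
    rw [inner_add_right, inner_smul_right, inner_smul_right, inner_zpowL2_shift, he1,
      mem_hardy_iff.1 he _ (by norm_num), mul_zero, zero_add, mul_one]
  set w : L2 := T g with hw
  have hwform : w = shift 1 (star h') := by
    refine Lp.ext ?_
    filter_upwards [hT g, shift_coe 1 (star h'), star_coe h', shift_coe 1 (T (mulOp s u)),
      hT (mulOp s u), mulOp_coe s u, hgcoe] with t h1 h2 h3 h4 h5 h6 h7
    rw [h1, h2, h3, h4, h5, h6, h7]
    have h12 := fourier_mul_fourier_neg 1 t
    simp only [map_mul, Complex.conj_ofReal, ← fourier_neg]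
    linear_combination (-((φ t - ν : ℝ) : ℂ) * s t * conj (u t)) * h12
  have hwcoef : ∀ n : ℤ, inner ℂ (zpowL2 n) w = conj (inner ℂ (zpowL2 (1 - n)) h') := by
    intro n
    rw [hwform, inner_zpowL2_shift, inner_zpowL2_star, neg_sub]
  -- The coefficient of `(φ - ν) g` at `1` is `d`.
  have hg0 : g ≠ 0 := by
    intro h0
    have h1 := hwcoef 1
    rw [hw, h0, map_zero, inner_zero_right, sub_self, hh0, Complex.conj_conj] at h1
    exact hd h1.symm
  set a := inner ℂ (zpowL2 0) w with ha
  set b := inner ℂ (zpowL2 1) w with hb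
  -- `v` is the `H²` part of `w = (φ - ν) g`, whose coefficients vanish from `2` on. `V` will be the
  -- line through `v`.
  set v : L2 := a • zpowL2 0 + b • zpowL2 1 with hv
  have hwv : ∀ f ∈ hardy, inner ℂ f (w - v) = 0 := by
    intro f hf
    refine inner_eq_zero_of_mem_hardy hf fun n hn => ?_
    rw [inner_sub_right, hv, inner_add_right, inner_smul_right, inner_smul_right,
      inner_zpowL2_zpowL2, inner_zpowL2_zpowL2]
    obtain rfl | rfl | hn : n = 0 ∨ n = 1 ∨ 2 ≤ n := by lia
    · simp [ha]
    · simp [hb]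
    · rw [hwcoef, mem_hardy_iff.1 hhH _ (by lia), if_neg (by lia), if_neg (by lia)]
      simp
  -- Constant modulus of `u` enters here: `conj g * w = D * 2 Re (d z)`, which has mean zero. This
  -- gives `g ⟂ v`.
  have hgw : inner ℂ g w = 0 := by
    have h1 : inner ℂ g w = ∫ t, D * d * (fourier 0 t * fourier 1 t) +
        D * conj d * (fourier 0 t * fourier (-1) t) ∂arc := by
      rw [inner_eq_integral]
      refine integral_congr_ae ?_
      filter_upwards [hT g, hgcoe, h, hD] with t h1 h2 h3 h4
      have h5 := congrArg (fun r : ℝ => (r : ℂ)) h3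
      have h6 := congrArg (fun r : ℝ => (r : ℂ)) h4
      simp only [ofReal_two_mul_re] at h5
      push_cast at h5 h6
      rw [← Complex.conj_mul'] at h6
      rw [h1, h2, fourier_zero, map_mul, Complex.conj_conj, Complex.conj_ofReal]
      push_cast
      linear_combination (D : ℂ) * h5 + ((φ t - ν : ℂ) * s t ^ 2) * h6
    have hint : ∀ (r : ℂ) (m n : ℤ),
        Integrable (fun t : Torus => r * (fourier m t * fourier n t)) arc := fun r m n =>
      (by fun_prop : Continuous fun t : Torus =>
        r * (fourier m t * fourier n t)).integrable_of_hasCompactSupport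
        (HasCompactSupport.of_compactSpace _)
    rw [h1, integral_add (hint _ _ _) (hint _ _ _), integral_const_mul, integral_const_mul,
      integral_fourier_mul_fourier, integral_fourier_mul_fourier]
    simp
  have hgv : inner ℂ g v = 0 := by
    have h1 := hwv g hgH
    rw [inner_sub_right, hgw, zero_sub, neg_eq_zero] at h1
    exact h1
  have hgV : g ∈ hardyMinus (ℂ ∙ v) :=
    ⟨hgH, Submodule.mem_orthogonal_singleton_iff_inner_left.2 hgv⟩
  refine ⟨ℂ ∙ v, ?_, ⟨g, hgV⟩, fun h0 => hg0 (congrArg Subtype.val h0), ?_⟩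
  · rw [Submodule.span_singleton_le_iff_mem, affinePolys, Submodule.mem_span_pair]
    exact ⟨a, b, rfl⟩
  · have hφg : mulOp φ g = (ν : ℂ) • g + w := by
      change _ = _ + (mulOp φ g - (ν : ℂ) • g)
      abel
    have hw0 : w ∈ (hardyMinus (ℂ ∙ v))ᗮ := by
      rw [Submodule.mem_orthogonal]
      intro f hf
      rw [← sub_add_cancel w v, inner_add_right, hwv f hf.1, zero_add]
      exact Submodule.mem_orthogonal_singleton_iff_inner_left.1 hf.2
    change (hardyMinus (ℂ ∙ v)).orthogonalProjectionOnto (mulOp φ g) = _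
    rw [hφg, map_add, map_smul, Submodule.orthogonalProjectionOnto_eq_zero_iff.2 hw0, add_zero]
    congr 1
    exact Submodule.orthogonalProjectionOnto_mem_subspace_eq_self (⟨g, hgV⟩ : hardyMinus (ℂ ∙ v))

/-! ### Sign comparison and the points between two eigenvalues. -/

theorem arc_singleton (x : Torus) : arc {x} = 0 := by
  have h := AddCircle.volume_closedBall (2 * Real.pi) (x := x) 0
  rw [Metric.closedBall_zero, AddCircle.volume_eq_smul_haarAddCircle, Measure.smul_apply,
    smul_eq_mul, mul_zero, min_eq_right Real.two_pi_pos.le, ENNReal.ofReal_zero,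
    mul_eq_zero] at h
  refine h.resolve_left ?_
  rw [ENNReal.ofReal_eq_zero, not_le]
  exact Real.two_pi_pos

theorem ae_two_mul_re_ne_zero {c : ℂ} (hc : c ≠ 0) :
    ∀ᵐ t ∂arc, 2 * (c * fourier 1 t).re ≠ 0 := by
  have hfin : {z : ℂ | z ^ 2 = -conj c / c}.Finite := by
    refine (Polynomial.nthRoots 2 (-conj c / c)).toFinset.finite_toSet.subset fun z hz => ?_
    simpa [Polynomial.mem_nthRoots] using hz
  have hinj : Function.Injective (fun t : Torus => fourier 1 t) := by
    intro a b hab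
    simp only [fourier_one] at hab
    exact AddCircle.injective_toCircle Real.two_pi_pos.ne' (Subtype.ext hab)
  have hfin' := hfin.preimage hinj.injOn
  have hnull : arc ((fun t : Torus => fourier 1 t) ⁻¹' {z : ℂ | z ^ 2 = -conj c / c}) = 0 := by
    rw [← Set.biUnion_of_singleton ((fun t : Torus => fourier 1 t) ⁻¹' _),
      measure_biUnion_null_iff hfin'.countable]
    exact fun x _ => arc_singleton x
  refine measure_mono_null (fun t ht => ?_) hnull
  have h1 : 2 * (c * fourier 1 t).re = 0 := not_not.1 ht
  have h2 := ofReal_two_mul_re c t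
  have h3 := fourier_mul_fourier_neg 1 t
  rw [h1, Complex.ofReal_zero] at h2
  change fourier 1 t ^ 2 = -conj c / c
  rw [eq_div_iff hc]
  linear_combination -fourier 1 t * h2 - conj c * h3

/-- If the half circle `Re (d z) > 0` is contained in `Re (c z) ≥ 0` up to a null set, then `c` is
a positive multiple of `d`. -/
theorem exists_pos_mul_eq {c d : ℂ} (hc : c ≠ 0) (hd : d ≠ 0)
    (h : ∀ᵐ t ∂arc, 0 < (d * fourier 1 t).re → 0 ≤ (c * fourier 1 t).re) :
    ∃ r : ℝ, 0 < r ∧ c = r * d := by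
  have hall : ∀ t : Torus, 0 < (d * fourier 1 t).re → 0 ≤ (c * fourier 1 t).re := by
    have hopen : IsOpen {t : Torus | ¬ (0 < (d * fourier 1 t).re → 0 ≤ (c * fourier 1 t).re)} := by
      have : {t : Torus | ¬ (0 < (d * fourier 1 t).re → 0 ≤ (c * fourier 1 t).re)} =
          {t | 0 < (d * fourier 1 t).re} ∩ {t | (c * fourier 1 t).re < 0} := by
        ext t
        simp
      rw [this]
      exact (isOpen_lt (by fun_prop) (by fun_prop)).inter (isOpen_lt (by fun_prop) (by fun_prop))
    have hempty := (hopen.measure_eq_zero_iff arc).1 h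
    intro t
    by_contra ht
    exact (hempty ▸ ht : t ∈ (∅ : Set Torus))
  have hplane : ∀ z : ℂ, 0 < (d * z).re → 0 ≤ (c * z).re := by
    intro z hz
    have hz0 : z ≠ 0 := by
      rintro rfl
      simp at hz
    have hn : 0 < ‖z‖ := norm_pos_iff.2 hz0
    have hpol : z = ‖z‖ * fourier 1 ((Complex.arg z : ℝ) : Torus) := by
      rw [fourier_coe_apply]
      conv_lhs => rw [← Complex.norm_mul_exp_arg_mul_I z]
      congr 2
      have : (Real.pi : ℂ) ≠ 0 := by exact_mod_cast Real.pi_ne_zero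
      push_cast
      field_simp
    have hre : ∀ e : ℂ, (e * z).re =
        ‖z‖ * (e * fourier 1 ((Complex.arg z : ℝ) : Torus)).re := by
      intro e
      conv_lhs => rw [hpol]
      rw [mul_left_comm, Complex.re_ofReal_mul]
    rw [hre] at hz ⊢
    exact mul_nonneg hn.le (hall _ (pos_of_mul_pos_right hz hn.le))
  have hρ : ∀ v : ℂ, 0 < v.re → 0 ≤ (c / d * v).re := by
    intro v hv
    have := hplane (v / d) (by rwa [mul_div_cancel₀ _ hd])
    rwa [div_mul_eq_mul_div, ← mul_div_assoc] at *
  have him : (c / d).im = 0 := by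
    by_contra him
    -- The imaginary part is chosen so that the product has real part `-1`.
    have := hρ ⟨1, ((c / d).re + 1) / (c / d).im⟩ one_pos
    rw [Complex.mul_re] at this
    simp only [mul_one] at this
    rw [mul_div_cancel₀ _ him] at this
    linarith
  have hre : c / d = ((c / d).re : ℂ) := Complex.ext rfl (by simp [him])
  have h1 : 0 ≤ (c / d).re := by simpa using hρ 1 one_pos
  refine ⟨(c / d).re, h1.lt_of_ne fun h0 => ?_, by rw [← hre, div_mul_cancel₀ _ hd]⟩
  rw [← h0, Complex.ofReal_zero, div_eq_zero_iff] at hre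
  exact hre.elim hc hd

theorem mem_eigenvaluesNeil_of_mem_Ioo {φ : Lp ℝ ∞ arc} {g k : L2} {x y ν : ℝ} {c d : ℂ}
    (hc : c ≠ 0) (hd : d ≠ 0)
    (hx : ∀ᵐ t ∂arc, (φ t - x) * ‖g t‖ ^ 2 = 2 * (c * fourier 1 t).re)
    (hy : ∀ᵐ t ∂arc, (φ t - y) * ‖k t‖ ^ 2 = 2 * (d * fourier 1 t).re)
    (hν : ν ∈ Set.Ioo x y) : (ν : ℂ) ∈ eigenvaluesNeil φ := by
  obtain ⟨hν1, hν2⟩ := hν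
  obtain ⟨r, hr, rfl⟩ := exists_pos_mul_eq hc hd (by
    filter_upwards [hx, hy] with t h1 h2 h3
    have h4 : 0 < φ t - y := by
      by_contra! h5
      nlinarith [mul_nonneg (neg_nonneg.2 h5) (sq_nonneg ‖k t‖)]
    nlinarith [mul_nonneg (by linarith : 0 ≤ φ t - x) (sq_nonneg ‖g t‖)])
  set q : Torus → ℝ := fun t => 2 * (d * fourier 1 t).re with hq
  -- `φ` avoids the gap `(x, y)` wherever `q ≠ 0`, so `|φ - ν| ≥ δ` there and `q / (φ - ν)` is
  -- bounded.
  set δ : ℝ := min (y - ν) (ν - x) with hδ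
  have hδ0 : 0 < δ := lt_min (by linarith) (by linarith)
  have hpos : ∀ᵐ t ∂arc, 0 < q t → δ ≤ φ t - ν := by
    filter_upwards [hy] with t h2 h3
    have h4 : 0 < φ t - y := by
      by_contra! h5
      rw [hq] at h3
      nlinarith [mul_nonneg (neg_nonneg.2 h5) (sq_nonneg ‖k t‖)]
    linarith [min_le_left (y - ν) (ν - x)]
  have hneg : ∀ᵐ t ∂arc, q t < 0 → φ t - ν ≤ -δ := by
    filter_upwards [hx] with t h2 h3
    have h6 : 2 * (r * d * fourier 1 t).re = r * q t := by
      rw [hq, mul_assoc, Complex.re_ofReal_mul]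
      ring
    have h4 : φ t - x < 0 := by
      by_contra! h5
      have h7 := mul_nonneg h5 (sq_nonneg ‖g t‖)
      rw [h2, h6] at h7
      nlinarith
    linarith [min_le_right (y - ν) (ν - x)]
  have hqb : ∀ t, |q t| ≤ 2 * ‖d‖ := by
    intro t
    rw [hq, abs_mul, abs_two]
    gcongr
    refine (Complex.abs_re_le_norm _).trans ?_
    rw [norm_mul]
    refine mul_le_of_le_one_right (norm_nonneg _) ?_
    rw [fourier_apply, Circle.norm_coe]
  have hcases : ∀ᵐ t ∂arc, 0 ≤ q t / (φ t - ν) ∧ q t / (φ t - ν) ≤ 2 * ‖d‖ / δ ∧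
      (φ t - ν) * (q t / (φ t - ν)) = q t := by
    filter_upwards [hpos, hneg] with t h1 h2
    have hb := hqb t
    rcases lt_trichotomy (q t) 0 with h3 | h3 | h3
    · have h4 := h2 h3
      refine ⟨div_nonneg_of_nonpos h3.le (by linarith), ?_, mul_div_cancel₀ _ (by linarith)⟩
      rw [← neg_div_neg_eq]
      refine div_le_div₀ (by positivity) ?_ hδ0 (by linarith)
      rwa [abs_of_neg h3] at hb
    · rw [h3, zero_div, mul_zero]
      exact ⟨le_rfl, by positivity, rfl⟩
    · have h4 := h1 h3
      refine ⟨div_nonneg h3.le (by linarith), ?_, mul_div_cancel₀ _ (by linarith)⟩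
      refine div_le_div₀ (by positivity) ?_ hδ0 h4
      rwa [abs_of_pos h3] at hb
  have hmeas : AEStronglyMeasurable (fun t => Real.sqrt (q t / (φ t - ν))) arc := by
    have h1 : AEMeasurable (fun t => φ t) arc := (Lp.aestronglyMeasurable φ).aemeasurable
    have h2 : AEMeasurable q arc :=
      (by fun_prop : Continuous fun t : Torus => 2 * (d * fourier 1 t).re).measurable.aemeasurable
    exact (h2.div (h1.sub_const ν)).sqrt.aestronglyMeasurable
  have hmem : MemLp (fun t => Real.sqrt (q t / (φ t - ν))) ∞ arc := by
    refine memLp_top_of_bound hmeas (Real.sqrt (2 * ‖d‖ / δ)) ?_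
    filter_upwards [hcases] with t ht
    rw [Real.norm_of_nonneg (Real.sqrt_nonneg _)]
    exact Real.sqrt_le_sqrt ht.2.1
  refine mem_eigenvaluesNeil_of_mul_sq (s := hmem.toLp) hd ?_
  filter_upwards [hmem.coeFn_toLp, hcases] with t h1 h2
  rw [h1, Real.sq_sqrt h2.1, h2.2.2]

/-! ### The degenerate case `c = 0`. -/

theorem ae_add_right {P : Torus → Prop} (h : ∀ᵐ t ∂arc, P t) (a : Torus) :
    ∀ᵐ t ∂arc, P (t + a) :=
  (measurePreserving_add_right arc a).quasiMeasurePreserving.ae h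

/-- Two distinct eigenvalues cannot occur if one of the trigonometric polynomials vanishes. -/
theorem eq_of_mul_norm_sq_eq_zero {φ : Lp ℝ ∞ arc} {g k : L2} {x y : ℝ} {d : ℂ}
    (hg : g ∈ hardy) (hg0 : g ≠ 0) (hk : k ∈ hardy) (hk0 : k ≠ 0)
    (hx : ∀ᵐ t ∂arc, (φ t - x) * ‖g t‖ ^ 2 = 0)
    (hy : ∀ᵐ t ∂arc, (φ t - y) * ‖k t‖ ^ 2 = 2 * (d * fourier 1 t).re) : y = x := by
  by_contra hxy
  have hx' : ∀ᵐ t ∂arc, g t ≠ 0 → φ t = x := by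
    filter_upwards [hx] with t ht hgt
    exact sub_eq_zero.1 ((mul_eq_zero.1 ht).resolve_right (by simpa using hgt))
  by_cases hd : d = 0
  · refine (eq_zero_or_eq_zero_of_mul_ae_eq_zero hg hk ?_).elim hg0 hk0
    filter_upwards [hx', hy] with t h1 h2
    by_contra hne
    have hne' := mul_ne_zero_iff.1 hne
    rw [hd, zero_mul, Complex.zero_re, mul_zero, h1 hne'.1] at h2
    rcases mul_eq_zero.1 h2 with h3 | h3
    · exact hxy (sub_eq_zero.1 h3).symm
    · exact hne'.2 (by simpa using h3)
  -- Where `g ≠ 0`, `φ = x` fixes the sign of `Re (d z)`, so `g` lives on a half circle. Its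
  -- half-turn rotate lives on the opposite one, and their product vanishes.
  · obtain ⟨a, hhalf⟩ : ∃ a : Torus, ∀ t : Torus, fourier 1 (t + a) = -fourier 1 t :=
      ⟨_, fun t => fourier_add_half_inv_index one_ne_zero Real.two_pi_pos t⟩
    have hsign : ∀ᵐ t ∂arc, g t ≠ 0 → 0 ≤ (x - y) * (d * fourier 1 t).re := by
      filter_upwards [hx', hy] with t h1 h2 hgt
      rw [h1 hgt] at h2
      have h3 : (x - y) * (d * fourier 1 t).re = (x - y) ^ 2 * ‖k t‖ ^ 2 / 2 := by
        linear_combination (-(x - y) / 2) * h2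
      rw [h3]
      positivity
    have hsign' : ∀ᵐ t ∂arc, g (t + a) ≠ 0 → 0 ≤ (x - y) * (d * fourier 1 (t + a)).re :=
      ae_add_right hsign a
    have hzero := eq_zero_or_eq_zero_of_mul_ae_eq_zero hg (rotate_mem_hardy hg a) (by
      filter_upwards [hsign, hsign', rotate_coe a g, ae_two_mul_re_ne_zero hd] with t h1 h2 h3 h4
      rw [h3]
      by_contra hne
      have hne' := mul_ne_zero_iff.1 hne
      have h5 := h1 hne'.1
      have h6 := h2 hne'.2
      rw [hhalf, mul_neg, Complex.neg_re] at h6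
      have h7 : (x - y) * (d * fourier 1 t).re = 0 := by linarith
      rcases mul_eq_zero.1 h7 with h8 | h8
      · exact hxy (sub_eq_zero.1 h8).symm
      · exact h4 (by rw [h8, mul_zero]))
    exact hzero.elim hg0 fun h => hg0 (rotate_eq_zero h)

end NeilToeplitz

end

theorem corollary3p3 (φ : MeasureTheory.Lp ℝ ⊤ NeilToeplitz.arc) :
    NeilToeplitz.eigenvaluesNeil φ = ∅ ∨
    (∃ x : ℝ, NeilToeplitz.eigenvaluesNeil φ = {(x : ℂ)}) ∨
    (∃ I : Set ℝ, I.OrdConnected ∧ I.Nontrivial ∧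
      NeilToeplitz.eigenvaluesNeil φ = (fun x : ℝ => (x : ℂ)) '' I) := by
  set I : Set ℝ := {x : ℝ | (x : ℂ) ∈ NeilToeplitz.eigenvaluesNeil φ} with hI
  have himage : NeilToeplitz.eigenvaluesNeil φ = (fun x : ℝ => (x : ℂ)) '' I := by
    ext l
    constructor
    · intro hl
      obtain ⟨x, rfl, -⟩ := NeilToeplitz.exists_of_mem_eigenvaluesNeil hl
      exact ⟨x, hl, rfl⟩
    · rintro ⟨x, hx, rfl⟩
      exact hx
  rcases I.subsingleton_or_nontrivial with hsub | hnt
  · rcases hsub.eq_empty_or_singleton with h | ⟨x, h⟩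
    · left
      rw [himage, h, Set.image_empty]
    · right
      left
      exact ⟨x, by rw [himage, h, Set.image_singleton]⟩
  · right
    right
    -- A second eigenvalue is what forces `c ≠ 0`.
    have hne : ∀ x ∈ I, ∃ g ∈ NeilToeplitz.hardy, g ≠ 0 ∧ ∃ c : ℂ, c ≠ 0 ∧
        ∀ᵐ t ∂NeilToeplitz.arc, (φ t - x) * ‖g t‖ ^ 2 = 2 * (c * fourier 1 t).re := by
      intro x hx
      obtain ⟨x', hxx, g, hg, hg0, c, hgc⟩ := NeilToeplitz.exists_of_mem_eigenvaluesNeil hx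
      obtain rfl := Complex.ofReal_injective hxx
      refine ⟨g, hg, hg0, c, ?_, hgc⟩
      rintro rfl
      obtain ⟨y, hy, hyx⟩ := hnt.exists_ne x
      obtain ⟨y', hyy, k, hk, hk0, d, hkd⟩ := NeilToeplitz.exists_of_mem_eigenvaluesNeil hy
      obtain rfl := Complex.ofReal_injective hyy
      refine hyx (NeilToeplitz.eq_of_mul_norm_sq_eq_zero hg hg0 hk hk0 ?_ hkd)
      simpa using hgc
    refine ⟨I, ⟨fun x hx y hy ν hν => ?_⟩, hnt, himage⟩
    obtain ⟨g, -, -, c, hc, hgc⟩ := hne x hx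
    obtain ⟨k, -, -, d, hd, hkd⟩ := hne y hy
    rcases hν.1.eq_or_lt with rfl | h1
    · exact hx
    rcases hν.2.eq_or_lt with rfl | h2
    · exact hy
    exact NeilToeplitz.mem_eigenvaluesNeil_of_mem_Ioo hc hd hgc hkd ⟨h1, h2⟩
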